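/- Let $G$ be a finite simple graph on $n\ge 7$ vertices whose average degree $d=\frac1n\sum_{v\in V(G)}\deg(v)$ satisfies $d\le \frac n4-1$. Then for every $r\ge 0$ the number $k_r(G)$ of $r$-vertex cliques of $G$ can be reconstructed from any $n-1$ of its cards. That is: the deck of a graph $F$ is the multiset of the isomorphism classes of the vertex-deleted induced subgraphs (cards) $F-v$, $v\in V(F)$; if $D$ is any sub-multiset of $n-1$ cards of the deck of $G$ and $H$ is any graph on $n$ vertices (with no condition on its average degree) whose deck also contains $D$ as a sub-multiset, then $k_r(H)=k_r(G)$. -/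

import Mathlib

universe u

/-- Two graphs (on arbitrary vertex types) are identified when they are isomorphic. -/
def graphIsoSetoid : Setoid (Σ V : Type u, SimpleGraph V) where
  r A B := Nonempty (A.2 ≃g B.2)
  iseqv :=
    { refl := fun _ => ⟨SimpleGraph.Iso.refl⟩
      symm := fun ⟨e⟩ => ⟨e.symm⟩
      trans := fun ⟨e⟩ ⟨f⟩ => ⟨e.trans f⟩ }

/-- Isomorphism classes of graphs, i.e. unlabelled graphs. -/
def UnlabelledGraph : Type (u + 1) := Quotient graphIsoSetoid.{u}

/-- The isomorphism class of a graph. -/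
def unlabelled {V : Type u} (G : SimpleGraph V) : UnlabelledGraph.{u} :=
  Quotient.mk graphIsoSetoid ⟨V, G⟩

/-- The card `G - v`: the subgraph induced on all vertices other than `v`. -/
def vertexCard {V : Type u} (G : SimpleGraph V) (v : V) : SimpleGraph ({v}ᶜ : Set V) :=
  G.induce {v}ᶜ

/-- The deck of `G`: the multiset of its (unlabelled) cards, one for each vertex. -/
def deck {V : Type u} [Fintype V] (G : SimpleGraph V) : Multiset UnlabelledGraph.{u} :=
  (Finset.univ : Finset V).val.map fun v => unlabelled (vertexCard G v)

/-- The `K_r`-count of `G`: the number of `r`-element cliques in `G`. -/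
noncomputable def cliqueCount {V : Type u} (G : SimpleGraph V) (r : ℕ) : ℕ :=
  (G.cliqueSet r).ncard

open Classical in
/-- The average degree of `G`. -/
noncomputable def averageDegree {V : Type u} [Fintype V] (G : SimpleGraph V) : ℝ :=
  (∑ v, (G.degree v : ℝ)) / (Fintype.card V : ℝ)

/-- The `K_r`-count of `G` can be reconstructed from `k` cards: whichever `k` cards of the deck
of `G` are given, every graph with the same number of vertices which also has these cards
(with multiplicity) in its deck has the same `K_r`-count as `G`. -/
def CliqueCountReconstructible {V : Type u} [Fintype V] (G : SimpleGraph V) (r k : ℕ) : Prop :=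
  ∀ D : Multiset UnlabelledGraph.{u}, D ≤ deck G → D.card = k →
    ∀ (W : Type u) [Fintype W] (H : SimpleGraph W),
      Fintype.card W = Fintype.card V → D ≤ deck H → cliqueCount H r = cliqueCount G r

/-! Put both graphs on one vertex set, so that G - u ≅ H - u for every u other than one vertex v.
Each card determines deg_G(u) - deg_H(u) up to a constant τ independent of u. Then deg_H(v) -
deg_G(v) = (n - 3)τ, which forces |τ| ≤ 1. Comparing degree squares and walks of length two excludes
τ = ±1 for a sparse graph (`degree_ne_succ_of_sparse`), so all degrees agree.

Suppose t = k_r(G) - k_r(H) > 0. Then every u ≠ v lies in exactly t more r-cliques of G than of H.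
Sparsity yields an attained degree j ≤ n - 4 such that j + 1 is not attained (`exists_degree_gap`).
For such j a card G - u shows which non-neighbours of u have degree j and how many r-cliques contain
them. Double counting then makes the classes "degree j, θ cliques" of G and H nonempty together
(`levelSet_card_le`). If deg(v) ≠ j, passing between G and H would shift θ by t forever, so deg(v) =
j.

The values θ_i = cliquesAt(v) + it for i < n - r are then each taken in G by exactly one vertex X_i
of degree j, with X_0 = v, while in H the value θ_i belongs to X_(i+1). Comparing adjacencies on the
cards makes v adjacent to all other X_i. Since 4r ≤ n, these are at least 3n/4 vertices of degree at
least 3n/4 - 1, too many edges for a sparse graph. -/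

open Finset Classical

/-! ### What a single card determines about degrees and cliques. -/

section PuncturedIso

variable {V : Type u}

/-- `G - u` and `H - u` are isomorphic, for graphs `G` and `H` on the same vertex set. -/
def PuncturedIso (G H : SimpleGraph V) (u : V) : Prop :=
  ∃ π : Equiv.Perm V, π u = u ∧
    ∀ x y, x ≠ u → y ≠ u → (H.Adj (π x) (π y) ↔ G.Adj x y)

theorem PuncturedIso.symm {G H : SimpleGraph V} {u : V} (h : PuncturedIso G H u) :
    PuncturedIso H G u := by
  obtain ⟨π, hu, h⟩ := h
  refine ⟨π.symm, by rw [Equiv.symm_apply_eq, hu], fun x y hx hy => ?_⟩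
  have hne : ∀ z, z ≠ u → π.symm z ≠ u := fun z hz h' => hz (by
    rw [Equiv.symm_apply_eq, hu] at h'; exact h')
  simpa using (h (π.symm x) (π.symm y) (hne x hx) (hne y hy)).symm

theorem isNClique_map_perm {G H : SimpleGraph V} {u : V} {π : Equiv.Perm V}
    (h : ∀ x y, x ≠ u → y ≠ u → (H.Adj (π x) (π y) ↔ G.Adj x y)) {r : ℕ} {s : Finset V}
    (hs : G.IsNClique r s) (hus : u ∉ s) : H.IsNClique r (s.map π.toEmbedding) := by
  refine ⟨?_, by rw [card_map, hs.card_eq]⟩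
  intro a ha b hb hab
  simp only [coe_map, Set.mem_image, mem_coe] at ha hb
  obtain ⟨x, hx, rfl⟩ := ha
  obtain ⟨y, hy, rfl⟩ := hb
  exact (h x y (fun e => hus (e ▸ hx)) (fun e => hus (e ▸ hy))).2
    (hs.isClique hx hy fun e => hab (by rw [e]))

variable [Fintype V]

/-- The number of `r`-cliques. -/
noncomputable def numCliques (G : SimpleGraph V) (r : ℕ) : ℕ :=
  #{s : Finset V | G.IsNClique r s}

/-- The number of `r`-cliques containing the vertex `x`. -/
noncomputable def cliquesAt (G : SimpleGraph V) (r : ℕ) (x : V) : ℕ :=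
  #{s : Finset V | G.IsNClique r s ∧ x ∈ s}

/-- The number of neighbours of `x` other than `u`. -/
noncomputable def degreeOff (G : SimpleGraph V) (u x : V) : ℕ :=
  #{y : V | y ≠ u ∧ G.Adj x y}

theorem sum_cliquesAt (G : SimpleGraph V) (r : ℕ) :
    ∑ x, cliquesAt G r x = r * numCliques G r := by
  have h : ∀ x, cliquesAt G r x =
      ∑ s : Finset V with G.IsNClique r s, if x ∈ s then 1 else 0 := by
    intro x
    rw [cliquesAt, ← filter_filter, card_filter]
  simp_rw [h]
  rw [sum_comm, numCliques, mul_comm, ← smul_eq_mul, ← sum_const]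
  refine sum_congr rfl fun s hs => ?_
  simpa using (mem_filter.1 hs).2.card_eq

theorem cliquesAt_add_avoiding (G : SimpleGraph V) (r : ℕ) (u : V) :
    cliquesAt G r u + #{s : Finset V | G.IsNClique r s ∧ u ∉ s} = numCliques G r := by
  rw [cliquesAt, numCliques, ← card_filter_add_card_filter_not (s := {s | G.IsNClique r s})
    (fun s => u ∈ s), filter_filter, filter_filter]

theorem PuncturedIso.avoiding_le {G H : SimpleGraph V} {u : V} (h : PuncturedIso G H u)
    (r : ℕ) :
    #{s : Finset V | G.IsNClique r s ∧ u ∉ s} ≤ #{s : Finset V | H.IsNClique r s ∧ u ∉ s} := by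
  obtain ⟨π, hu, h⟩ := h
  refine card_le_card_of_injOn (fun s => s.map π.toEmbedding) ?_
    ((map_injective _).injOn)
  intro s hs
  simp only [coe_filter, mem_univ, true_and, Set.mem_ofPred_eq] at hs ⊢
  refine ⟨isNClique_map_perm h hs.1 hs.2, fun hm => hs.2 ?_⟩
  obtain ⟨y, hy, e⟩ := mem_map.1 hm
  have : y = u := π.injective (by rw [hu]; exact e)
  exact this ▸ hy

theorem cliquesAt_eq_of_not_adj (G : SimpleGraph V) (r : ℕ) {x u : V} (hxu : x ≠ u)
    (h : ¬ G.Adj x u) :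
    cliquesAt G r x = #{s : Finset V | G.IsNClique r s ∧ x ∈ s ∧ u ∉ s} := by
  rw [cliquesAt]
  congr 1
  ext s
  simp only [mem_filter, mem_univ, true_and]
  constructor
  · exact fun ⟨a, b⟩ => ⟨a, b, fun c => h (a.isClique b c hxu)⟩
  · exact fun ⟨a, b, _⟩ => ⟨a, b⟩

theorem card_cliques_through_le {G H : SimpleGraph V} {u : V} {π : Equiv.Perm V} (hu : π u = u)
    (h : ∀ x y, x ≠ u → y ≠ u → (H.Adj (π x) (π y) ↔ G.Adj x y)) (r : ℕ) (x : V) :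
    #{s : Finset V | G.IsNClique r s ∧ x ∈ s ∧ u ∉ s} ≤
      #{s : Finset V | H.IsNClique r s ∧ π x ∈ s ∧ u ∉ s} := by
  refine card_le_card_of_injOn (fun s => s.map π.toEmbedding) ?_
    ((map_injective _).injOn)
  intro s hs
  simp only [coe_filter, mem_univ, true_and, Set.mem_ofPred_eq] at hs ⊢
  refine ⟨isNClique_map_perm h hs.1 hs.2.2, mem_map_of_mem _ hs.2.1, fun hm => hs.2.2 ?_⟩
  obtain ⟨y, hy, e⟩ := mem_map.1 hm
  have : y = u := π.injective (by rw [hu]; exact e)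
  exact this ▸ hy

theorem card_cliques_through_eq {G H : SimpleGraph V} {u : V} {π : Equiv.Perm V} (hu : π u = u)
    (h : ∀ x y, x ≠ u → y ≠ u → (H.Adj (π x) (π y) ↔ G.Adj x y)) (r : ℕ) (x : V) :
    #{s : Finset V | G.IsNClique r s ∧ x ∈ s ∧ u ∉ s} =
      #{s : Finset V | H.IsNClique r s ∧ π x ∈ s ∧ u ∉ s} := by
  refine le_antisymm (card_cliques_through_le hu h r x) ?_
  have hne : ∀ z, z ≠ u → π.symm z ≠ u := fun z hz h' => hz (by
    rw [Equiv.symm_apply_eq, hu] at h'; exact h')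
  have := card_cliques_through_le (G := H) (H := G) (u := u) (π := π.symm)
    (by rw [Equiv.symm_apply_eq, hu])
    (fun a b ha hb => by simpa using (h _ _ (hne a ha) (hne b hb)).symm) r (π x)
  simpa using this

theorem degreeOff_eq {G H : SimpleGraph V} {u : V} {π : Equiv.Perm V} (hu : π u = u)
    (h : ∀ x y, x ≠ u → y ≠ u → (H.Adj (π x) (π y) ↔ G.Adj x y)) {x : V} (hx : x ≠ u) :
    degreeOff H u (π x) = degreeOff G u x := by
  rw [degreeOff, degreeOff]
  symm
  refine card_equiv π fun y => ?_
  simp only [mem_filter, mem_univ, true_and]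
  have : π y ≠ u ↔ y ≠ u := by
    rw [not_iff_not]
    exact ⟨fun e => π.injective (e.trans hu.symm), fun e => by rw [e, hu]⟩
  rw [this]
  exact and_congr_right fun hy => (h x y hx hy).symm

theorem degreeOff_add (G : SimpleGraph V) (u x : V) :
    degreeOff G u x + (if G.Adj x u then 1 else 0) = G.degree x := by
  rw [degreeOff, ← SimpleGraph.card_neighborFinset_eq_degree]
  have : (univ.filter fun y => y ≠ u ∧ G.Adj x y) = (G.neighborFinset x).erase u := by
    ext y; simp
  rw [this]
  split_ifs with h
  · exact card_erase_add_one (by simpa using h)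
  · rw [erase_eq_of_notMem (by simpa using h), add_zero]

/-- The card determines its own degree multiset. The subtracted term removes x = u, which is not a
vertex of the card. -/
theorem PuncturedIso.sum_comp_degreeOff {G H : SimpleGraph V} {u : V} (h : PuncturedIso G H u)
    (φ : ℤ → ℤ) :
    ∑ x, φ (degreeOff G u x) - φ (G.degree u) = ∑ x, φ (degreeOff H u x) - φ (H.degree u) := by
  obtain ⟨π, hu, h⟩ := h
  have hself : ∀ K : SimpleGraph V, degreeOff K u u = K.degree u := fun K => by
    simpa using degreeOff_add K u u
  rw [← hself G, ← hself H, sub_eq_sub_iff_add_eq_add,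
    ← add_sum_erase univ (fun x => φ (degreeOff G u x)) (mem_univ u),
    ← add_sum_erase univ (fun x => φ (degreeOff H u x)) (mem_univ u)]
  have : ∑ x ∈ univ.erase u, φ (degreeOff G u x) = ∑ x ∈ univ.erase u, φ (degreeOff H u x) := by
    refine sum_equiv π (fun x => ?_) fun x hx => ?_
    · simp only [mem_erase, mem_univ, and_true]
      rw [not_iff_not]
      exact ⟨fun e => by rw [e, hu], fun e => π.injective (e.trans hu.symm)⟩
    · rw [degreeOff_eq hu h (ne_of_mem_erase hx)]
  rw [this]; ring

/-- The vertices outside the closed neighbourhood of `u` which have degree `j` and lie in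
`θ` cliques of size `r`. -/
noncomputable def farVertices (G : SimpleGraph V) (r j : ℕ) (θ : ℤ) (u : V) : Finset V :=
  {x | x ≠ u ∧ ¬ G.Adj x u ∧ G.degree x = j ∧ (cliquesAt G r x : ℤ) = θ}

/-- A vertex of degree j in H - u has degree j in H and is not adjacent to u, or has degree j + 1
and is adjacent; the gap excludes the latter. Cliques through a non-neighbour of u avoid u, so the
card retains them all. -/
theorem PuncturedIso.card_farVertices_le {G H : SimpleGraph V} {u : V} (h : PuncturedIso G H u)
    (r : ℕ) {j : ℕ} (hH : ∀ x, H.degree x ≠ j + 1) (θ : ℤ) :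
    #(farVertices G r j θ u) ≤ #(farVertices H r j θ u) := by
  obtain ⟨π, hu, h⟩ := h
  refine card_le_card_of_injOn π ?_ π.injective.injOn
  intro x hx
  simp only [farVertices, coe_filter, mem_univ, true_and, Set.mem_ofPred_eq] at hx ⊢
  obtain ⟨hxu, hadj, hd, hc⟩ := hx
  have hπx : π x ≠ u := fun e => hxu (π.injective (e.trans hu.symm))
  have e1 := degreeOff_add G u x
  have e2 := degreeOff_add H u (π x)
  rw [degreeOff_eq hu h hxu] at e2
  rw [if_neg hadj, add_zero] at e1
  have hna : ¬ H.Adj (π x) u := by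
    intro hc'
    rw [if_pos hc', e1, hd] at e2
    exact hH _ e2.symm
  rw [if_neg hna, add_zero, e1, hd] at e2
  refine ⟨hπx, hna, e2.symm, ?_⟩
  rw [cliquesAt_eq_of_not_adj H r hπx hna, ← card_cliques_through_eq hu h,
    ← cliquesAt_eq_of_not_adj G r hxu hadj, hc]

theorem PuncturedIso.card_farVertices_eq {G H : SimpleGraph V} {u : V} (h : PuncturedIso G H u)
    (r : ℕ) {j : ℕ} (hG : ∀ x, G.degree x ≠ j + 1) (hH : ∀ x, H.degree x ≠ j + 1) (θ : ℤ) :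
    #(farVertices G r j θ u) = #(farVertices H r j θ u) :=
  le_antisymm (h.card_farVertices_le r hH θ) (h.symm.card_farVertices_le r hG θ)

/-- The cliques avoiding u are those of the card, so they cancel. -/
theorem cliquesAt_sub_eq {G H : SimpleGraph V} {u : V} (h : PuncturedIso G H u) (r : ℕ) :
    (cliquesAt G r u : ℤ) - cliquesAt H r u = numCliques G r - numCliques H r := by
  have e := le_antisymm (h.avoiding_le r) (h.symm.avoiding_le r)
  have eG := cliquesAt_add_avoiding G r u
  have eH := cliquesAt_add_avoiding H r u
  omega

/-- The number of cliques at the missing vertex, when all other cards agree. -/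
theorem cliquesAt_missing {G H : SimpleGraph V} {v : V} (h : ∀ u, u ≠ v → PuncturedIso G H u)
    (r : ℕ) :
    (cliquesAt H r v : ℤ) = cliquesAt G r v +
      ((Fintype.card V : ℤ) - r - 1) * (numCliques G r - numCliques H r) := by
  have hsum : ∑ u ∈ univ.erase v, ((cliquesAt G r u : ℤ) - cliquesAt H r u) =
      ((Fintype.card V : ℤ) - 1) * (numCliques G r - numCliques H r) := by
    rw [sum_congr rfl fun u hu => cliquesAt_sub_eq (h u (ne_of_mem_erase hu)) r, sum_const,
      card_erase_of_mem (mem_univ v), card_univ, nsmul_eq_mul,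
      Nat.cast_sub (Fintype.card_pos_iff.2 ⟨v⟩), Nat.cast_one]
  have key := add_sum_erase univ (fun u => (cliquesAt G r u : ℤ) - cliquesAt H r u) (mem_univ v)
  have hG : (∑ x, (cliquesAt G r x : ℤ)) = r * numCliques G r := by
    exact_mod_cast sum_cliquesAt G r
  have hH : (∑ x, (cliquesAt H r x : ℤ)) = r * numCliques H r := by
    exact_mod_cast sum_cliquesAt H r
  rw [hsum, sum_sub_distrib, hG, hH] at key
  linear_combination -key

theorem le_degree_of_cliquesAt_pos (G : SimpleGraph V) {r : ℕ} {x : V}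
    (h : 0 < cliquesAt G r x) : r ≤ G.degree x + 1 := by
  obtain ⟨s, hs⟩ := card_pos.1 h
  obtain ⟨hs, hx⟩ := (mem_filter.1 hs).2
  have : s.erase x ⊆ G.neighborFinset x := by
    intro y hy
    rw [SimpleGraph.mem_neighborFinset]
    exact hs.isClique hx (mem_of_mem_erase hy) (ne_of_mem_erase hy).symm
  have := card_le_card this
  rw [card_erase_of_mem hx, hs.card_eq, SimpleGraph.card_neighborFinset_eq_degree] at this
  omega

end PuncturedIso

/-! ### The degrees of a sparse graph are determined. -/

section Degrees

variable {V : Type u} [Fintype V]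

/-- The number of walks of length two starting at `u`. -/
noncomputable def neighborDegreeSum (G : SimpleGraph V) (u : V) : ℤ :=
  ∑ x, if G.Adj x u then (G.degree x : ℤ) else 0

theorem sum_adj_eq_degree (G : SimpleGraph V) (u : V) :
    ∑ x, (if G.Adj x u then (1 : ℤ) else 0) = G.degree u := by
  rw [← SimpleGraph.card_neighborFinset_eq_degree, SimpleGraph.neighborFinset_eq_filter,
    card_filter]
  push_cast
  exact sum_congr rfl fun x _ => by simp [G.adj_comm]

theorem degreeOff_cast (G : SimpleGraph V) (u x : V) :
    (degreeOff G u x : ℤ) = G.degree x - if G.Adj x u then 1 else 0 := by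
  have := degreeOff_add G u x
  split_ifs at this ⊢ <;> omega

theorem sum_degreeOff (G : SimpleGraph V) (u : V) :
    ∑ x, (degreeOff G u x : ℤ) = ∑ x, (G.degree x : ℤ) - G.degree u := by
  simp_rw [degreeOff_cast]
  rw [sum_sub_distrib, sum_adj_eq_degree]

theorem sum_sq_degreeOff (G : SimpleGraph V) (u : V) :
    ∑ x, (degreeOff G u x : ℤ) ^ 2 =
      ∑ x, (G.degree x : ℤ) ^ 2 - 2 * neighborDegreeSum G u + G.degree u := by
  rw [neighborDegreeSum, ← sum_adj_eq_degree G u, mul_sum, ← sum_sub_distrib, ← sum_add_distrib]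
  refine sum_congr rfl fun x _ => ?_
  rw [degreeOff_cast]
  split_ifs <;> ring

theorem sum_neighborDegreeSum (G : SimpleGraph V) :
    ∑ u, neighborDegreeSum G u = ∑ x, (G.degree x : ℤ) ^ 2 := by
  simp_rw [neighborDegreeSum]
  rw [sum_comm]
  refine sum_congr rfl fun x _ => ?_
  rw [sq]
  nth_rw 2 [← sum_adj_eq_degree G x]
  rw [sum_mul]
  exact sum_congr rfl fun y _ => by simp [G.adj_comm]

theorem PuncturedIso.degree_sub {G H : SimpleGraph V} {u : V} (h : PuncturedIso G H u) :
    2 * ((G.degree u : ℤ) - H.degree u) = ∑ x, (G.degree x : ℤ) - ∑ x, (H.degree x : ℤ) := by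
  have := h.sum_comp_degreeOff (fun z => z)
  beta_reduce at this
  rw [sum_degreeOff, sum_degreeOff] at this
  linarith

theorem PuncturedIso.sq_degree {G H : SimpleGraph V} {u : V} (h : PuncturedIso G H u) :
    ∑ x, (G.degree x : ℤ) ^ 2 - 2 * neighborDegreeSum G u + G.degree u - G.degree u ^ 2 =
      ∑ x, (H.degree x : ℤ) ^ 2 - 2 * neighborDegreeSum H u + H.degree u - H.degree u ^ 2 := by
  have := h.sum_comp_degreeOff (fun z => z ^ 2)
  simpa only [sum_sq_degreeOff] using this

theorem sum_erase_sq (G : SimpleGraph V) (v : V) :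
    ∑ u ∈ univ.erase v, (∑ x, (G.degree x : ℤ) ^ 2 - 2 * neighborDegreeSum G u + G.degree u -
        G.degree u ^ 2) =
      ((Fintype.card V : ℤ) - 4) * ∑ x, (G.degree x : ℤ) ^ 2 + 2 * neighborDegreeSum G v +
        ∑ x, (G.degree x : ℤ) - G.degree v + G.degree v ^ 2 := by
  have key := add_sum_erase univ (fun u => (∑ x, (G.degree x : ℤ) ^ 2 -
    2 * neighborDegreeSum G u + G.degree u - (G.degree u : ℤ) ^ 2)) (mem_univ v)
  have total : ∑ u, (∑ x, (G.degree x : ℤ) ^ 2 - 2 * neighborDegreeSum G u + G.degree u -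
      (G.degree u : ℤ) ^ 2) = ((Fintype.card V : ℤ) - 3) * ∑ x, (G.degree x : ℤ) ^ 2 +
        ∑ x, (G.degree x : ℤ) := by
    rw [sum_sub_distrib, sum_add_distrib, sum_sub_distrib, ← mul_sum,
      sum_neighborDegreeSum, sum_const, card_univ, nsmul_eq_mul]
    ring
  rw [total] at key
  linear_combination key

theorem sum_sq_missing {G H : SimpleGraph V} {v : V} (h : ∀ u, u ≠ v → PuncturedIso G H u) :
    ((Fintype.card V : ℤ) - 4) * ∑ x, (G.degree x : ℤ) ^ 2 + 2 * neighborDegreeSum G v +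
        ∑ x, (G.degree x : ℤ) - G.degree v + G.degree v ^ 2 =
      ((Fintype.card V : ℤ) - 4) * ∑ x, (H.degree x : ℤ) ^ 2 + 2 * neighborDegreeSum H v +
        ∑ x, (H.degree x : ℤ) - H.degree v + H.degree v ^ 2 := by
  rw [← sum_erase_sq, ← sum_erase_sq]
  exact sum_congr rfl fun u hu => (h u (ne_of_mem_erase hu)).sq_degree

theorem degree_le_neighborDegreeSum (G : SimpleGraph V) (v : V) :
    (G.degree v : ℤ) ≤ neighborDegreeSum G v := by
  rw [← sum_adj_eq_degree, neighborDegreeSum]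
  refine sum_le_sum fun x _ => ?_
  split_ifs with h
  · have : 0 < G.degree x := (G.degree_pos_iff_exists_adj x).2 ⟨v, h⟩
    omega
  · rfl

theorem neighborDegreeSum_le (G : SimpleGraph V) (v : V) :
    neighborDegreeSum G v ≤ ((Fintype.card V : ℤ) - 1) * G.degree v := by
  rw [← sum_adj_eq_degree G v, neighborDegreeSum, mul_sum]
  refine sum_le_sum fun x _ => ?_
  split_ifs
  · have := G.degree_lt_card_verts x
    omega
  · simp

/-- The degree jump at v makes the sum of squares of H exceed that of G, since G is sparse. Summing
the second-moment identity over the cards, with trivial bounds on the walks from v, gives the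
opposite inequality. -/
theorem degree_ne_succ_of_sparse {G H : SimpleGraph V} {v : V}
    (h : ∀ u, u ≠ v → PuncturedIso G H u) (hn : 7 ≤ Fintype.card V)
    -- The slack 8 = 4 · 2 lets the roles be swapped when the other graph, with degree sum smaller
    -- by 2, is the sparse one.
    (hd : 4 * ∑ x, (G.degree x : ℤ) ≤ Fintype.card V * (Fintype.card V - 4) + 8)
    (hs : ∑ x, (G.degree x : ℤ) = ∑ x, (H.degree x : ℤ) + 2)
    (hv : (H.degree v : ℤ) = G.degree v + (Fintype.card V - 3)) : False := by
  have hstep : ∀ u, u ≠ v → (H.degree u : ℤ) = G.degree u - 1 := fun u hu => by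
    have := (h u hu).degree_sub
    omega
  have hsq : ∑ x ∈ univ.erase v, ((G.degree x : ℤ) ^ 2 - (H.degree x : ℤ) ^ 2) =
      2 * (∑ x, (G.degree x : ℤ) - G.degree v) - ((Fintype.card V : ℤ) - 1) := by
    rw [sum_congr rfl fun u hu => by rw [hstep u (ne_of_mem_erase hu)],
      ← add_sum_erase univ (fun x => (G.degree x : ℤ)) (mem_univ v), add_sub_cancel_left,
      mul_sum]
    have : ((Fintype.card V : ℤ) - 1) = ∑ u ∈ univ.erase v, 1 := by
      rw [sum_const, card_erase_of_mem (mem_univ v), card_univ, nsmul_eq_mul,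
        Nat.cast_sub (by omega)]
      simp
    rw [this, ← sum_sub_distrib]
    exact sum_congr rfl fun u _ => by ring
  have key := add_sum_erase univ (fun x => (G.degree x : ℤ) ^ 2 - (H.degree x : ℤ) ^ 2)
    (mem_univ v)
  rw [hsq, sum_sub_distrib] at key
  have hmiss := sum_sq_missing h
  have hTH := degree_le_neighborDegreeSum H v
  have hTG := neighborDegreeSum_le G v
  have hlt := H.degree_lt_card_verts v
  generalize neighborDegreeSum G v = TG at *
  generalize neighborDegreeSum H v = TH at *
  generalize ∑ x, (G.degree x : ℤ) ^ 2 = QG at *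
  generalize ∑ x, (H.degree x : ℤ) ^ 2 = QH at *
  generalize ∑ x, (G.degree x : ℤ) = SG at *
  generalize ∑ x, (H.degree x : ℤ) = SH at *
  have hy : G.degree v ≤ 2 := by omega
  generalize G.degree v = y at *
  have hn' : (7 : ℤ) ≤ Fintype.card V := by exact_mod_cast hn
  rw [hv] at *
  generalize (Fintype.card V : ℤ) = n at *
  have hQ : QG = QH + (2 * (SG - y) - (n - 1) + (y ^ 2 - (y + (n - 3)) ^ 2)) := by linarith
  have hS : 2 * (SG - y) - (n - 1) + ((y : ℤ) ^ 2 - (y + (n - 3)) ^ 2) ≤ -1 := by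
    interval_cases y <;> push_cast <;> nlinarith
  subst hQ
  have := mul_le_mul_of_nonneg_left hS (by linarith : 0 ≤ n - 4)
  interval_cases y <;> push_cast at * <;> nlinarith

theorem degree_eq_of_sparse {G H : SimpleGraph V} {v : V}
    (h : ∀ u, u ≠ v → PuncturedIso G H u) (hn : 7 ≤ Fintype.card V)
    (hd : 4 * ∑ x, (G.degree x : ℤ) ≤ Fintype.card V * (Fintype.card V - 4)) (x : V) :
    G.degree x = H.degree x := by
  obtain ⟨u₀, hu₀⟩ := Fintype.exists_ne_of_one_lt_card (by omega : 1 < Fintype.card V) v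
  obtain ⟨τ, hτ⟩ : ∃ τ : ℤ, τ = (G.degree u₀ : ℤ) - H.degree u₀ := ⟨_, rfl⟩
  have hS : ∑ x, (G.degree x : ℤ) - ∑ x, (H.degree x : ℤ) = 2 * τ := by
    rw [hτ, (h u₀ hu₀).degree_sub]
  have hstep : ∀ u, u ≠ v → (G.degree u : ℤ) - H.degree u = τ := fun u hu => by
    have := (h u hu).degree_sub
    omega
  have key := add_sum_erase univ (fun x => (G.degree x : ℤ) - H.degree x) (mem_univ v)
  rw [sum_congr rfl fun u hu => hstep u (ne_of_mem_erase hu), sum_const,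
    card_erase_of_mem (mem_univ v), card_univ, nsmul_eq_mul, Nat.cast_sub (by omega),
    sum_sub_distrib, hS, Nat.cast_one] at key
  have hG := G.degree_lt_card_verts v
  have hH := H.degree_lt_card_verts v
  have hn' : (7 : ℤ) ≤ Fintype.card V := by exact_mod_cast hn
  have hv : (H.degree v : ℤ) - G.degree v = (Fintype.card V - 3) * τ := by linarith
  -- A change of 2(n - 3) exceeds the largest possible degree n - 1.
  have h1 : τ < 2 := by
    by_contra! hc
    nlinarith
  have h2 : -2 < τ := by
    by_contra! hc
    nlinarith
  obtain rfl | rfl | rfl : τ = -1 ∨ τ = 0 ∨ τ = 1 := by omega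
  · exact (degree_ne_succ_of_sparse (fun u hu => (h u hu).symm) hn (by linarith) (by linarith)
      (by linarith)).elim
  · rcases eq_or_ne x v with rfl | hx
    · omega
    · have := hstep x hx
      omega
  · exact (degree_ne_succ_of_sparse h hn (by linarith) (by linarith) (by linarith)).elim

end Degrees

/-! ### Classes of vertices with given degree and clique count. -/

section Levels

variable {V : Type u} [Fintype V]

/-- The vertices of degree `j` lying in `θ` cliques of size `r`. -/
noncomputable def levelSet (G : SimpleGraph V) (r j : ℕ) (θ : ℤ) : Finset V :=
  {x | G.degree x = j ∧ (cliquesAt G r x : ℤ) = θ}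

theorem mem_levelSet {G : SimpleGraph V} {r j : ℕ} {θ : ℤ} {x : V} :
    x ∈ levelSet G r j θ ↔ G.degree x = j ∧ (cliquesAt G r x : ℤ) = θ := by
  simp [levelSet]

theorem farVertices_eq (G : SimpleGraph V) (r j : ℕ) (θ : ℤ) (u : V) :
    farVertices G r j θ u = {x ∈ levelSet G r j θ | x ≠ u ∧ ¬ G.Adj x u} := by
  ext x
  simp only [farVertices, levelSet, mem_filter, mem_univ, true_and]
  tauto

theorem card_nonneighbors (G : SimpleGraph V) (x : V) :
    (#{u : V | x ≠ u ∧ ¬ G.Adj x u} : ℤ) = Fintype.card V - 1 - G.degree x := by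
  have h := G.degree_compl x
  have hlt := G.degree_lt_card_verts x
  rw [← SimpleGraph.card_neighborFinset_eq_degree, SimpleGraph.neighborFinset_eq_filter] at h
  simp only [SimpleGraph.compl_adj] at h
  have : #{u : V | x ≠ u ∧ ¬ G.Adj x u} = Fintype.card V - 1 - G.degree x := by
    rw [← h]
  omega

/-- Each vertex of the class is far from its n - 1 - j non-neighbours. -/
theorem sum_card_farVertices (G : SimpleGraph V) (r j : ℕ) (θ : ℤ) :
    ∑ u, (#(farVertices G r j θ u) : ℤ) =
      ((Fintype.card V : ℤ) - 1 - j) * #(levelSet G r j θ) := by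
  simp_rw [farVertices_eq, card_filter]
  push_cast
  rw [sum_comm, mul_comm, ← nsmul_eq_mul, ← sum_const]
  refine sum_congr rfl fun x hx => ?_
  rw [← (mem_levelSet.1 hx).1, ← card_nonneighbors, card_filter]
  push_cast
  rfl

theorem mul_card_levelSet_sub {G H : SimpleGraph V} {v : V}
    (h : ∀ u, u ≠ v → PuncturedIso G H u) (r : ℕ) {j : ℕ}
    (hG : ∀ x, G.degree x ≠ j + 1) (hH : ∀ x, H.degree x ≠ j + 1) (θ : ℤ) :
    ((Fintype.card V : ℤ) - 1 - j) * (#(levelSet G r j θ) - #(levelSet H r j θ)) =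
      #(farVertices G r j θ v) - #(farVertices H r j θ v) := by
  have hsum : ∑ u ∈ univ.erase v, (#(farVertices G r j θ u) : ℤ) =
      ∑ u ∈ univ.erase v, (#(farVertices H r j θ u) : ℤ) :=
    sum_congr rfl fun u hu => by
      rw [(h u (ne_of_mem_erase hu)).card_farVertices_eq r hG hH]
  have eG := add_sum_erase univ (fun u => (#(farVertices G r j θ u) : ℤ)) (mem_univ v)
  have eH := add_sum_erase univ (fun u => (#(farVertices H r j θ u) : ℤ)) (mem_univ v)
  rw [sum_card_farVertices] at eG eH
  linear_combination eH - eG + hsum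

/-- The factor n - 1 - j is at least 3, while the right side of `mul_card_levelSet_sub` is at most
the class size in G. Used both ways, this transfers nonemptiness and size one between G and H. -/
theorem levelSet_card_le {G H : SimpleGraph V} {v : V}
    (h : ∀ u, u ≠ v → PuncturedIso G H u) (r : ℕ) {j : ℕ} (hj : j + 4 ≤ Fintype.card V)
    (hG : ∀ x, G.degree x ≠ j + 1) (hH : ∀ x, H.degree x ≠ j + 1) (θ : ℤ) :
    2 * #(levelSet G r j θ) ≤ 3 * #(levelSet H r j θ) := by
  have key := mul_card_levelSet_sub h r hG hH θ
  have hle : #(farVertices G r j θ v) ≤ #(levelSet G r j θ) := by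
    rw [farVertices_eq]
    exact card_filter_le _ _
  by_contra! hc
  have : (3 : ℤ) * (#(levelSet G r j θ) - #(levelSet H r j θ)) ≤
      ((Fintype.card V : ℤ) - 1 - j) * (#(levelSet G r j θ) - #(levelSet H r j θ)) :=
    mul_le_mul_of_nonneg_right (by omega) (by omega)
  omega

theorem cliquesAt_le (G : SimpleGraph V) (r : ℕ) (x : V) : cliquesAt G r x ≤ numCliques G r := by
  have := cliquesAt_add_avoiding G r x
  omega

/-- Without a gap, every degree from the minimum up to n - 3 occurs, and the upper ones alone exceed
the degree sum. -/
theorem exists_degree_gap (G : SimpleGraph V) (hn : 7 ≤ Fintype.card V)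
    (hd : 4 * ∑ x, (G.degree x : ℤ) ≤ Fintype.card V * (Fintype.card V - 4)) :
    ∃ x₀, G.degree x₀ + 4 ≤ Fintype.card V ∧ ∀ x, G.degree x ≠ G.degree x₀ + 1 := by
  by_contra! hc
  have hne : Nonempty V := Fintype.card_pos_iff.1 (by omega)
  obtain ⟨z, -, hz⟩ := exists_min_image univ (fun x => G.degree x) univ_nonempty
  have hzle : 4 * (G.degree z : ℤ) ≤ Fintype.card V - 4 := by
    have : (Fintype.card V : ℤ) * G.degree z ≤ ∑ x, (G.degree x : ℤ) := by
      rw [← card_univ, ← nsmul_eq_mul, ← sum_const]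
      exact sum_le_sum fun x hx => by exact_mod_cast hz x hx
    by_contra! hlt
    nlinarith
  have hall : ∀ k, G.degree z + k + 3 ≤ Fintype.card V → ∃ x, G.degree x = G.degree z + k := by
    intro k
    induction k with
    | zero => exact fun _ => ⟨z, rfl⟩
    | succ k ih =>
      intro hk
      obtain ⟨x, hx⟩ := ih (by omega)
      obtain ⟨x', hx'⟩ := hc x (by omega)
      exact ⟨x', by omega⟩
  obtain ⟨m, hm⟩ : ∃ m, m = (Fintype.card V - 2) / 2 := ⟨_, rfl⟩
  have hsub : Icc m (Fintype.card V - 3) ⊆ image (fun x => G.degree x) {x | m ≤ G.degree x} := by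
    intro j hj
    rw [mem_Icc] at hj
    obtain ⟨x, hx⟩ := hall (j - G.degree z) (by omega)
    exact mem_image.2 ⟨x, by simp; omega, by omega⟩
  have hcard := (card_le_card hsub).trans card_image_le
  rw [Nat.card_Icc] at hcard
  have hsum : (m : ℤ) * #{x | m ≤ G.degree x} ≤ ∑ x, (G.degree x : ℤ) := by
    calc (m : ℤ) * #{x | m ≤ G.degree x} = ∑ x with m ≤ G.degree x, (m : ℤ) := by
          rw [sum_const, nsmul_eq_mul, mul_comm]
      _ ≤ ∑ x with m ≤ G.degree x, (G.degree x : ℤ) :=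
          sum_le_sum fun x hx => by exact_mod_cast (mem_filter.1 hx).2
      _ ≤ _ := sum_le_sum_of_subset_of_nonneg (filter_subset _ _) fun _ _ _ => by positivity
  have hcard' : (Fintype.card V : ℤ) - 2 - m ≤ #{x | m ≤ G.degree x} := by omega
  have h2 := mul_le_mul_of_nonneg_left hcard' (by positivity : (0 : ℤ) ≤ m)
  -- The lower bound m(n - 2 - m) is m² or m² + m, just above n(n - 4)/4, which is m² - 1 or m² + m
  -- - 3/4.
  have hm1 : (Fintype.card V : ℤ) = 2 * m + 2 ∨ (Fintype.card V : ℤ) = 2 * m + 3 := by omega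
  rcases hm1 with e | e <;> rw [e] at hd h2 <;> nlinarith

/-- Every u ≠ v lies in an r-clique of G, hence has degree at least r - 1. -/
theorem four_mul_le_card {G H : SimpleGraph V} {v : V}
    (h : ∀ u, u ≠ v → PuncturedIso G H u) (hn : 7 ≤ Fintype.card V)
    (hd : 4 * ∑ x, (G.degree x : ℤ) ≤ Fintype.card V * (Fintype.card V - 4)) {r : ℕ}
    (hlt : numCliques H r < numCliques G r) : 4 * r ≤ Fintype.card V := by
  have hdeg : ∀ u ∈ univ.erase v, (r : ℤ) - 1 ≤ G.degree u := fun u hu => by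
    have h1 := cliquesAt_sub_eq (h u (ne_of_mem_erase hu)) r
    have := le_degree_of_cliquesAt_pos G (r := r) (x := u) (by omega)
    omega
  have hsum := sum_le_sum hdeg
  rw [sum_const, card_erase_of_mem (mem_univ v), card_univ, nsmul_eq_mul, Nat.cast_sub (by omega),
    Nat.cast_one] at hsum
  have key := add_sum_erase univ (fun x => (G.degree x : ℤ)) (mem_univ v)
  by_contra! hc
  have h3 : (Fintype.card V : ℤ) - 3 ≤ 4 * (r - 1) := by omega
  have := mul_le_mul_of_nonneg_left h3 (by omega : 0 ≤ (Fintype.card V : ℤ) - 1)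
  nlinarith

/-- In a degree class avoiding v, a nonempty class at θ in G gives one in H, which is the class at θ
+ t in G. Clique counts would be unbounded. -/
theorem degree_eq_of_gap {G H : SimpleGraph V} {v : V}
    (h : ∀ u, u ≠ v → PuncturedIso G H u) (hdeg : ∀ x, G.degree x = H.degree x) {r : ℕ}
    (hlt : numCliques H r < numCliques G r) {x₀ : V} (hx₀ : G.degree x₀ + 4 ≤ Fintype.card V)
    (hgap : ∀ x, G.degree x ≠ G.degree x₀ + 1) : G.degree v = G.degree x₀ := by
  by_contra hv
  have hgap' : ∀ x, H.degree x ≠ G.degree x₀ + 1 := fun x => hdeg x ▸ hgap x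
  have hchain : ∀ k : ℕ, (levelSet G r (G.degree x₀) (cliquesAt G r x₀ +
      k * ((numCliques G r : ℤ) - numCliques H r))).Nonempty := by
    intro k
    induction k with
    | zero => exact ⟨x₀, mem_levelSet.2 ⟨rfl, by simp⟩⟩
    | succ k ih =>
      rw [← card_pos] at ih
      have hle := levelSet_card_le h r hx₀ hgap hgap' (cliquesAt G r x₀ +
        k * ((numCliques G r : ℤ) - numCliques H r))
      obtain ⟨x, hx⟩ := card_pos.1 (by omega : 0 < #(levelSet H r (G.degree x₀)
        (cliquesAt G r x₀ + k * ((numCliques G r : ℤ) - numCliques H r))))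
      obtain ⟨hxd, hxc⟩ := mem_levelSet.1 hx
      rw [← hdeg] at hxd
      have hxv : x ≠ v := fun e => hv (e ▸ hxd)
      have := cliquesAt_sub_eq (h x hxv) r
      refine ⟨x, mem_levelSet.2 ⟨hxd, ?_⟩⟩
      push_cast
      linear_combination this + hxc
  obtain ⟨x, hx⟩ := hchain (numCliques G r + 1)
  have h1 := (mem_levelSet.1 hx).2
  have h2 := cliquesAt_le G r x
  push_cast at h1
  have h3 : (1 : ℤ) ≤ (numCliques G r : ℤ) - numCliques H r := by omega
  nlinarith

/-- A second vertex of the class starts a descent by steps of t. Below the count of v the descent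
never meets v, so it reaches negative clique counts. -/
theorem levelSet_missing {G H : SimpleGraph V} {v : V}
    (h : ∀ u, u ≠ v → PuncturedIso G H u) (hdeg : ∀ x, G.degree x = H.degree x) {r : ℕ}
    (hlt : numCliques H r < numCliques G r) (hv : G.degree v + 4 ≤ Fintype.card V)
    (hgap : ∀ x, G.degree x ≠ G.degree v + 1) :
    levelSet G r (G.degree v) (cliquesAt G r v) = {v} := by
  have hgap' : ∀ x, H.degree x ≠ G.degree v + 1 := fun x => hdeg x ▸ hgap x
  have h3 : (1 : ℤ) ≤ (numCliques G r : ℤ) - numCliques H r := by omega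
  refine eq_singleton_iff_unique_mem.2 ⟨mem_levelSet.2 ⟨rfl, rfl⟩, fun x hx => ?_⟩
  by_contra hxv
  have hchain : ∀ k : ℕ, ∃ x, x ≠ v ∧ x ∈ levelSet G r (G.degree v) (cliquesAt G r v -
      k * ((numCliques G r : ℤ) - numCliques H r)) := by
    intro k
    induction k with
    | zero => exact ⟨x, hxv, by simpa using hx⟩
    | succ k ih =>
      obtain ⟨z, hzv, hz⟩ := ih
      obtain ⟨hzd, hzc⟩ := mem_levelSet.1 hz
      have hz' : z ∈ levelSet H r (G.degree v) (cliquesAt G r v -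
          ((k + 1 : ℕ) : ℤ) * ((numCliques G r : ℤ) - numCliques H r)) := by
        refine mem_levelSet.2 ⟨by rw [← hdeg, hzd], ?_⟩
        have := cliquesAt_sub_eq (h z hzv) r
        push_cast
        linear_combination hzc - this
      have hle := levelSet_card_le (fun u hu => (h u hu).symm) r hv hgap' hgap (cliquesAt G r v -
          ((k + 1 : ℕ) : ℤ) * ((numCliques G r : ℤ) - numCliques H r))
      have hpos := card_pos.2 ⟨z, hz'⟩
      obtain ⟨w, hw⟩ := card_pos.1 (by omega : 0 < #(levelSet G r (G.degree v)
        (cliquesAt G r v - ((k + 1 : ℕ) : ℤ) * ((numCliques G r : ℤ) - numCliques H r))))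
      refine ⟨w, ?_, hw⟩
      rintro rfl
      have := (mem_levelSet.1 hw).2
      push_cast at this
      nlinarith
  obtain ⟨z, -, hz⟩ := hchain (cliquesAt G r v + 1)
  have h1 := (mem_levelSet.1 hz).2
  push_cast at h1
  nlinarith

/-- In the degree class of the missing vertex, the clique counts are in arithmetic progression. -/
theorem levelSet_progression {G H : SimpleGraph V} {v : V}
    (h : ∀ u, u ≠ v → PuncturedIso G H u) (hdeg : ∀ x, G.degree x = H.degree x) {r : ℕ}
    (hlt : numCliques H r < numCliques G r) (hv : G.degree v + 4 ≤ Fintype.card V)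
    (hgap : ∀ x, G.degree x ≠ G.degree v + 1) {N : ℕ} (hN : N + r = Fintype.card V) :
    (∀ i < N, #(levelSet G r (G.degree v) (cliquesAt G r v +
      i * ((numCliques G r : ℤ) - numCliques H r))) = 1) ∧
    ∀ i, i + 1 < N → levelSet H r (G.degree v) (cliquesAt G r v +
      i * ((numCliques G r : ℤ) - numCliques H r)) = levelSet G r (G.degree v) (cliquesAt G r v +
      ((i + 1 : ℕ) : ℤ) * ((numCliques G r : ℤ) - numCliques H r)) := by
  have hgap' : ∀ x, H.degree x ≠ G.degree v + 1 := fun x => hdeg x ▸ hgap x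
  have h3 : (1 : ℤ) ≤ (numCliques G r : ℤ) - numCliques H r := by omega
  have hmiss := cliquesAt_missing h r
  have hN' : (Fintype.card V : ℤ) - r - 1 = N - 1 := by omega
  rw [hN'] at hmiss
  -- Vertices other than v shift by t. The vertex v is in neither class: its value has index 0 in G
  -- and N - 1 in H.
  have hshift : ∀ i, i + 1 < N → levelSet H r (G.degree v) (cliquesAt G r v +
      i * ((numCliques G r : ℤ) - numCliques H r)) = levelSet G r (G.degree v) (cliquesAt G r v +
      ((i + 1 : ℕ) : ℤ) * ((numCliques G r : ℤ) - numCliques H r)) := by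
    intro i hi
    ext x
    rw [mem_levelSet, mem_levelSet, hdeg x]
    refine and_congr_right fun _ => ?_
    rcases eq_or_ne x v with rfl | hx
    · have hi' : (i : ℤ) + 1 ≤ N - 1 := by omega
      have := mul_le_mul_of_nonneg_right hi' (by linarith : 0 ≤ (numCliques G r : ℤ) - numCliques H r)
      push_cast
      constructor <;> intro e <;> nlinarith
    · have := cliquesAt_sub_eq (h x hx) r
      push_cast
      constructor <;> intro e <;> linarith
  refine ⟨fun i => ?_, hshift⟩
  induction i with
  | zero =>
    intro _
    simp [levelSet_missing h hdeg hlt hv hgap]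
  | succ i ih =>
    intro hi
    have ih := ih (by omega)
    rw [← hshift i hi]
    -- With size 1 in G and s in H, 2 ≤ 3s and 2s ≤ 3 leave only s = 1.
    have h1 := levelSet_card_le h r hv hgap hgap' (cliquesAt G r v +
      i * ((numCliques G r : ℤ) - numCliques H r))
    have h2 := levelSet_card_le (fun u hu => (h u hu).symm) r hv hgap' hgap (cliquesAt G r v +
      i * ((numCliques G r : ℤ) - numCliques H r))
    omega

/-- Reflection widens an interval by one at each end, so lengths 0 and 1 suffice as base cases. -/
theorem rel_of_reflect {N : ℕ} {R : ℕ → ℕ → Prop} (h0 : ∀ k, R k k)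
    (h1 : ∀ k, k + 1 < N → R k (k + 1))
    (hR : ∀ k i, k + 1 < N → i + 1 < N → R (k + 1) i → R k (i + 1)) :
    ∀ m k, k + m < N → R k (k + m)
  | 0, k, _ => h0 k
  | 1, k, hk => h1 k hk
  | m + 2, k, hk => by
    refine hR k (k + m + 1) (by omega) (by omega) ?_
    have := rel_of_reflect h0 h1 hR m (k + 1) (by omega)
    rwa [show k + 1 + m = k + m + 1 by omega] at this

theorem farVertices_nonempty_iff {G : SimpleGraph V} {r j : ℕ} {θ : ℤ} {x u : V}
    (hx : levelSet G r j θ = {x}) :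
    0 < #(farVertices G r j θ u) ↔ ¬ (x = u ∨ G.Adj x u) := by
  rw [card_pos, farVertices_eq, hx, filter_singleton]
  split_ifs with h
  · simpa [not_or] using h
  · simpa [not_or] using h

theorem numCliques_le_of_sparse {G H : SimpleGraph V} {v : V}
    (h : ∀ u, u ≠ v → PuncturedIso G H u) (hdeg : ∀ x, G.degree x = H.degree x)
    (hn : 7 ≤ Fintype.card V)
    (hd : 4 * ∑ x, (G.degree x : ℤ) ≤ Fintype.card V * (Fintype.card V - 4)) (r : ℕ) :
    numCliques G r ≤ numCliques H r := by
  by_contra! hlt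
  have h4r := four_mul_le_card h hn hd hlt
  obtain ⟨x₀, hx₀, hgap⟩ := exists_degree_gap G hn hd
  have hv := degree_eq_of_gap h hdeg hlt hx₀ hgap
  rw [← hv] at hx₀ hgap
  have hgap' : ∀ x, H.degree x ≠ G.degree v + 1 := fun x => hdeg x ▸ hgap x
  obtain ⟨N, hN⟩ : ∃ N, N + r = Fintype.card V := ⟨Fintype.card V - r, by omega⟩
  obtain ⟨hone, hshift⟩ := levelSet_progression h hdeg hlt hx₀ hgap hN
  have ht : (1 : ℤ) ≤ (numCliques G r : ℤ) - numCliques H r := by omega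
  generalize hT : (numCliques G r : ℤ) - numCliques H r = t at *
  have hex : ∀ i, ∃ x, i < N → levelSet G r (G.degree v) (cliquesAt G r v + i * t) = {x} := by
    intro i
    by_cases hi : i < N
    · obtain ⟨x, hx⟩ := card_eq_one.1 (hone i hi)
      exact ⟨x, fun _ => hx⟩
    · exact ⟨v, fun h => absurd h hi⟩
  choose X hX using hex
  have hmem : ∀ i < N, G.degree (X i) = G.degree v ∧
      (cliquesAt G r (X i) : ℤ) = cliquesAt G r v + i * t := fun i hi => by
    rw [← mem_levelSet, hX i hi]
    exact mem_singleton_self _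
  have hX0 : X 0 = v := by
    have h1 := hX 0 (by omega)
    have h2 := levelSet_missing h hdeg hlt hx₀ hgap
    simp only [Nat.cast_zero, zero_mul, add_zero] at h1
    rw [h2] at h1
    exact (singleton_injective h1).symm
  have hinj : Set.InjOn X (range N) := by
    intro i hi k hk e
    rw [coe_range, Set.mem_Iio] at hi hk
    have h1 := (hmem i hi).2
    rw [e, (hmem k hk).2] at h1
    have h2 : ((k : ℤ) - i) * t = 0 := by linarith
    rcases mul_eq_zero.1 h2 with h2 | h2 <;> omega
  -- The card at X (i + 1), which is not v, shows whether the single vertex of level k is far: this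
  -- is X k in G and X (k + 1) in H.
  have hcross : ∀ k i, k + 1 < N → i + 1 < N →
      ((X k = X (i + 1) ∨ G.Adj (X k) (X (i + 1))) ↔
        (X (k + 1) = X (i + 1) ∨ H.Adj (X (k + 1)) (X (i + 1)))) := by
    intro k i hk hi
    have hne : X (i + 1) ≠ v := fun e => by
      have := hinj (by simp; omega) (by simp; omega) (e.trans hX0.symm)
      omega
    have hG := hX k (by omega)
    have hH := (hshift k hk).trans (hX (k + 1) hk)
    rw [← not_iff_not, ← farVertices_nonempty_iff hG, ← farVertices_nonempty_iff hH,
      (h _ hne).card_farVertices_eq r hgap hgap']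
  have hclique : ∀ m, m < N → X 0 = X m ∨ G.Adj (X 0) (X m) := by
    intro m hm
    have := rel_of_reflect (N := N) (R := fun k i => X k = X i ∨ G.Adj (X k) (X i))
      (fun k => Or.inl rfl) (fun k hk => (hcross k k hk hk).2 (Or.inl rfl))
      -- Two uses of `hcross`, joined by symmetry of H, exchange k and i.
      (fun k i hk hi hki => by
        refine (hcross k i hk hi).2 ?_
        rw [eq_comm, H.adj_comm, ← hcross i k hi hk, eq_comm, G.adj_comm]
        exact hki) m 0 (by omega)
    simpa using this
  have hdv : N ≤ G.degree v + 1 := by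
    have hsub : (range N).image X ⊆ insert v (G.neighborFinset v) := by
      intro x hx
      obtain ⟨m, hm, rfl⟩ := mem_image.1 hx
      have := hclique m (mem_range.1 hm)
      rw [hX0] at this
      rw [mem_insert, SimpleGraph.mem_neighborFinset]
      exact this.imp Eq.symm id
    have := (card_le_card hsub).trans (card_insert_le _ _)
    rwa [card_image_of_injOn hinj, card_range, SimpleGraph.card_neighborFinset_eq_degree] at this
  have hsum : (N : ℤ) * G.degree v ≤ ∑ x, (G.degree x : ℤ) := by
    calc (N : ℤ) * G.degree v = ∑ x ∈ (range N).image X, (G.degree v : ℤ) := by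
          rw [sum_const, card_image_of_injOn hinj, card_range, nsmul_eq_mul]
      _ = ∑ x ∈ (range N).image X, (G.degree x : ℤ) := by
          refine sum_congr rfl fun x hx => ?_
          obtain ⟨m, hm, rfl⟩ := mem_image.1 hx
          rw [(hmem m (mem_range.1 hm)).1]
      _ ≤ _ := sum_le_sum_of_subset_of_nonneg (subset_univ _) fun _ _ _ => by positivity
  have hNn : 3 * (Fintype.card V : ℤ) ≤ 4 * N := by omega
  have hdv' : (N : ℤ) - 1 ≤ G.degree v := by omega
  have h5 := mul_le_mul_of_nonneg_left hdv' (by positivity : (0 : ℤ) ≤ N)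
  have hn' : (7 : ℤ) ≤ Fintype.card V := by exact_mod_cast hn
  nlinarith

end Levels

/-! ### From decks to graphs on a common vertex set. -/

section Decks

variable {V W : Type u}

theorem unlabelled_eq_iff {A : SimpleGraph V} {B : SimpleGraph W} :
    unlabelled A = unlabelled B ↔ Nonempty (A ≃g B) :=
  ⟨fun h => Quotient.exact h, fun h => Quotient.sound h⟩

/-- An isomorphism of graphs restricts to corresponding cards. -/
def isoVertexCard {A : SimpleGraph V} {B : SimpleGraph W} (e : A ≃g B) (u : V) :
    vertexCard A u ≃g vertexCard B (e u) where
  toEquiv := e.toEquiv.subtypeEquiv fun x => by simp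
  map_rel_iff' := by
    intro x y
    exact e.map_rel_iff'

theorem puncturedIso_of_card_eq {G H : SimpleGraph V} {u : V}
    (h : unlabelled (vertexCard G u) = unlabelled (vertexCard H u)) : PuncturedIso G H u := by
  obtain ⟨φ⟩ := unlabelled_eq_iff.1 h
  refine ⟨Equiv.Perm.ofSubtype (p := (· ∈ ({u}ᶜ : Set V))) φ.toEquiv,
    Equiv.Perm.ofSubtype_apply_of_not_mem _ (by simp), fun x y hx hy => ?_⟩
  rw [Equiv.Perm.ofSubtype_apply_of_mem _ (by simpa using hx),
    Equiv.Perm.ofSubtype_apply_of_mem _ (by simpa using hy)]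
  exact φ.map_rel_iff' (a := ⟨x, hx⟩) (b := ⟨y, hy⟩)

theorem cliqueCount_eq_of_iso {A : SimpleGraph V} {B : SimpleGraph W} (e : A ≃g B) (r : ℕ) :
    cliqueCount A r = cliqueCount B r := by
  refine Set.ncard_congr (fun s _ => s.map e.toEquiv.toEmbedding) ?_ ?_ ?_
  · intro s hs
    rw [SimpleGraph.mem_cliqueSet_iff] at hs ⊢
    have := hs.map (f := e.toEquiv.toEmbedding)
    refine this.mono ?_
    intro a b hab
    obtain ⟨_, x, y, hxy, rfl, rfl⟩ := hab
    exact e.map_rel_iff'.2 hxy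
  · intro s t _ _ hst
    exact map_injective _ hst
  · intro s hs
    rw [SimpleGraph.mem_cliqueSet_iff] at hs
    refine ⟨s.map e.symm.toEquiv.toEmbedding, ?_, ?_⟩
    · rw [SimpleGraph.mem_cliqueSet_iff]
      refine (hs.map (f := e.symm.toEquiv.toEmbedding)).mono ?_
      intro a b hab
      obtain ⟨_, x, y, hxy, rfl, rfl⟩ := hab
      exact e.symm.map_rel_iff'.2 hxy
    · ext x
      simp only [mem_map_equiv]
      exact iff_of_eq (congrArg (· ∈ s) (e.apply_symm_apply x))

theorem cliqueCount_eq_numCliques [Fintype V] (G : SimpleGraph V) (r : ℕ) :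
    cliqueCount G r = numCliques G r := by
  rw [cliqueCount, numCliques, ← Set.ncard_coe_finset]
  congr 1
  ext s
  simp

/-- Fibres over each value have equal size; glue bijections between them. -/
theorem exists_equiv_of_map_eq {γ : Type*} {f : V → γ} {g : W → γ}
    {s : Finset V} {t : Finset W} (h : s.val.map f = t.val.map g) :
    ∃ e : s ≃ t, ∀ x, g (e x) = f x := by
  have hcard : ∀ c, Nonempty ({x : s // f x = c} ≃ {y : t // g y = c}) := by
    intro c
    have := congrArg (Multiset.count c) h
    rw [Multiset.count_map, Multiset.count_map] at this
    have h1 : Fintype.card {x : s // f x = c} = #{x ∈ s | c = f x} := by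
      rw [Fintype.card_subtype, ← card_map (Function.Embedding.subtype _)]
      congr 1
      ext x
      simp [eq_comm, and_comm]
    have h2 : Fintype.card {y : t // g y = c} = #{y ∈ t | c = g y} := by
      rw [Fintype.card_subtype, ← card_map (Function.Embedding.subtype _)]
      congr 1
      ext x
      simp [eq_comm, and_comm]
    exact Fintype.card_eq.1 (h1.trans (Eq.trans this h2.symm))
  refine ⟨(Equiv.sigmaFiberEquiv fun x : s => f x).symm.trans
    ((Equiv.sigmaCongrRight fun c => (hcard c).some).trans
      (Equiv.sigmaFiberEquiv fun y : t => g y)), fun x => ?_⟩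
  exact ((hcard (f x)).some ⟨x, rfl⟩).2

theorem exists_missing_card [Fintype V] {G : SimpleGraph V} {D : Multiset UnlabelledGraph.{u}}
    (hD : D ≤ deck G) (hc : D.card + 1 = Fintype.card V) :
    ∃ v, D = (univ.erase v).val.map fun u => unlabelled (vertexCard G u) := by
  obtain ⟨R, hR⟩ := Multiset.le_iff_exists_add.1 hD
  have hcard : R.card = 1 := by
    have := congrArg Multiset.card hR
    rw [deck, Multiset.card_map, card_val, card_univ, Multiset.card_add] at this
    omega
  obtain ⟨c, rfl⟩ := Multiset.card_eq_one.1 hcard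
  have hmem : c ∈ deck G := by
    rw [hR]
    exact Multiset.mem_add.2 (Or.inr (Multiset.mem_singleton_self c))
  obtain ⟨v, -, rfl⟩ := Multiset.mem_map.1 hmem
  refine ⟨v, ?_⟩
  have h2 : deck G = (univ.erase v).val.map (fun u => unlabelled (vertexCard G u)) +
      {unlabelled (vertexCard G v)} := by
    rw [deck, erase_val, add_comm, Multiset.singleton_add,
      ← Multiset.map_cons (fun u => unlabelled (vertexCard G u)),
      Multiset.cons_erase (mem_univ_val v)]
  exact add_right_cancel (hR.symm.trans h2)

/-- Two graphs sharing all but one card can be put on the same vertex set so that the common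
cards correspond. -/
theorem exists_puncturedIso [Fintype V] [Fintype W] {G : SimpleGraph V} {H : SimpleGraph W}
    {D : Multiset UnlabelledGraph.{u}} (hG : D ≤ deck G) (hH : D ≤ deck H)
    (hV : D.card + 1 = Fintype.card V) (hW : D.card + 1 = Fintype.card W) :
    ∃ (H' : SimpleGraph V) (v : V), Nonempty (H' ≃g H) ∧
      ∀ u, u ≠ v → PuncturedIso G H' u := by
  obtain ⟨v, hv⟩ := exists_missing_card hG hV
  obtain ⟨w, hw⟩ := exists_missing_card hH hW
  obtain ⟨e, he⟩ := exists_equiv_of_map_eq (hv.symm.trans hw)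
  have hext : ∃ σ : V ≃ W, ∀ x : (univ.erase v : Finset V), σ x = e x := by
    obtain ⟨τ⟩ : Nonempty (V ≃ W) := Fintype.card_eq.1 (hV.symm.trans hW)
    have hinj : Set.InjOn (fun x => if hx : x ∈ univ.erase v then (e ⟨x, hx⟩ : W) else w)
        (univ.erase v : Finset V) := by
      intro x hx y hy hxy
      simp only [dif_pos (mem_coe.1 hx), dif_pos (mem_coe.1 hy)] at hxy
      simpa using e.injective (Subtype.ext hxy)
    obtain ⟨σ, hσ⟩ := exists_equiv_extend_of_card_eq (s := univ.erase v) (t := univ)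
      (by rw [card_univ]; omega) (subset_univ _) hinj
    refine ⟨σ.trans (Equiv.subtypeUnivEquiv fun x => mem_univ x), fun x => ?_⟩
    have := hσ x x.2
    simpa [dif_pos x.2] using this
  obtain ⟨σ, hσ⟩ := hext
  refine ⟨H.comap σ, v, ⟨SimpleGraph.Iso.comap σ H⟩, fun u hu => ?_⟩
  have hu' : u ∈ univ.erase v := mem_erase.2 ⟨hu, mem_univ u⟩
  refine puncturedIso_of_card_eq ?_
  rw [← he ⟨u, hu'⟩, ← hσ]
  exact (unlabelled_eq_iff.2 ⟨isoVertexCard (SimpleGraph.Iso.comap σ H) u⟩).symm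

theorem four_mul_sum_degree_le [Fintype V] {G : SimpleGraph V} (hn : 7 ≤ Fintype.card V)
    (hd : averageDegree G ≤ (Fintype.card V : ℝ) / 4 - 1) :
    4 * ∑ x, (G.degree x : ℤ) ≤ Fintype.card V * (Fintype.card V - 4) := by
  have hpos : (0 : ℝ) < Fintype.card V := by
    exact_mod_cast (by omega : 0 < Fintype.card V)
  rw [averageDegree, div_le_iff₀ hpos] at hd
  have : (4 : ℝ) * ∑ x, (G.degree x : ℝ) ≤ Fintype.card V * (Fintype.card V - 4) := by
    linarith
  exact_mod_cast this

end Decks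

theorem theorem2 {V : Type u} [Fintype V] (G : SimpleGraph V)
    (hn : 7 ≤ Fintype.card V)
    (hd : averageDegree G ≤ (Fintype.card V : ℝ) / 4 - 1) (r : ℕ) :
    CliqueCountReconstructible G r (Fintype.card V - 1) := by
  intro D hDG hc W _ H hW hDH
  obtain ⟨H', v, ⟨e⟩, h⟩ := exists_puncturedIso hDG hDH (by omega) (by omega)
  have hd' := four_mul_sum_degree_le hn hd
  have hdeg := degree_eq_of_sparse h hn hd'
  rw [← cliqueCount_eq_of_iso e, cliqueCount_eq_numCliques, cliqueCount_eq_numCliques]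
  refine le_antisymm ?_ (numCliques_le_of_sparse h hdeg hn hd' r)
  -- Equal degrees make H' sparse too, so the roles can be exchanged.
  refine numCliques_le_of_sparse (fun u hu => (h u hu).symm) (fun x => (hdeg x).symm) hn ?_ r
  simpa only [← hdeg] using hd'
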